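/- Let $KC$ be the set of Kolmogorov–Chaitin complex sequences: those $\alpha=\alpha_0\alpha_1\alpha_2\cdots\in\{-1,1\}^{\mathbb N}$ for which there is $k\in\mathbb N$ with $K(\alpha_0\cdots\alpha_{n-1})\ge n-k$ for all $n\in\mathbb N$, where $K$ is prefix-free Kolmogorov complexity (the length of a shortest program with respect to an optimal prefix-free machine). For $\alpha\in\{-1,1\}^{\mathbb N}$ put $\varepsilon_n(\alpha)=\alpha_n\in\{-1,1\}$. A sequence $(x_n)_{n\ge 0}$ of real numbers is called computable if there is a computable double sequence of rationals $(r_{n,k})$ with $|x_n-r_{n,k}|\le 2^{-k}$ for all $n,k\in\mathbb N$; a real number $t$ is computable if there is a computable sequence of rationals $(r_k)$ with $|t-r_k|\le 2^{-k}$ for all $k\in\mathbb N$. A sequence $(x_n)_{n\ge0}$ is called square computable if it is computable, $\sum_{n} x_n^2<\infty$, and there is a computable function $N:\mathbb N\to\mathbb N$ such that for every integer $m\ge1$ $$\left|\sum_{n=0}^{\infty}x_n^2-\sum_{n=0}^{N(m)}x_n^2\right|<\frac1m .$$ Theorem. Let $(x_n)_{n\ge0}$ be a square computable sequence of real numbers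 and $(\varphi_n)_{n\ge0}$ a computable sequence of real numbers. Then for every $\alpha\in KC$ and every computable real number $t$ the series $$\sum_{n=0}^{\infty}\varepsilon_n(\alpha)\,x_n\cos(2\pi nt+\varphi_n)$$ converges, that is, its partial sums have a limit in $\mathbb R$. -/

import Mathlib

open Filter Topology

/-! ## Prefix-free Kolmogorov complexity

Finite binary strings are elements of `List Bool`, infinite ones are functions `ℕ → Bool`; the bit
`true` stands for the symbol `1` and the bit `false` for the symbol `-1`. -/

/-- A prefix-free machine: a partial computable function on finite binary strings no two distinct
elements of whose domain are comparable in the prefix order. -/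
structure IsPrefixFreeMachine (M : List Bool →. List Bool) : Prop where
  partrec : Partrec M
  prefixFree : ∀ p q : List Bool, (M p).Dom → (M q).Dom → p <+: q → p = q

/-- The complexity of the string `a` relative to the machine `M`: the least length of a program
`p` with `M p = a`, and `⊤` if there is no such program. -/
noncomputable def machineComplexity (M : List Bool →. List Bool) (a : List Bool) : ℕ∞ :=
  ⨅ (p : List Bool) (_ : a ∈ M p), (p.length : ℕ∞)

/-- An optimal (universal) prefix-free machine: up to an additive constant, its complexity is below
that of every other prefix-free machine. -/
structure IsOptimalMachine (U : List Bool →. List Bool) : Prop where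
  isPrefixFreeMachine : IsPrefixFreeMachine U
  optimal : ∀ M : List Bool →. List Bool, IsPrefixFreeMachine M →
    ∃ c : ℕ, ∀ a : List Bool, machineComplexity U a ≤ machineComplexity M a + c

section OptimalMachine

open Nat.Partrec (Code)
open Encodable

/-- The string `1 1 ⋯ 1 0` with `n` ones. -/
def unaryHeader (n : ℕ) : List Bool :=
  (List.range n).map (fun _ => true) ++ [false]

theorem unaryHeader_length (n : ℕ) : (unaryHeader n).length = n + 1 := by
  simp [unaryHeader]

theorem unaryHeader_prefix (n m : ℕ) (p q : List Bool)
    (h : unaryHeader n ++ p <+: unaryHeader m ++ q) : n = m ∧ p <+: q := by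
  have key : ∀ n m : ℕ, List.replicate n true ++ false :: p <+: List.replicate m true ++ false :: q →
      n = m ∧ p <+: q := by
    intro n
    induction n with
    | zero =>
      intro m h
      cases m with
      | zero => simpa using h
      | succ m => simp [List.replicate_succ] at h
    | succ n ih =>
      intro m h
      cases m with
      | zero => simp [List.replicate_succ] at h
      | succ m =>
        simp only [List.replicate_succ, List.cons_append, List.cons_prefix_cons, true_and] at h
        have := ih m h
        exact ⟨by rw [this.1], this.2⟩
  apply key
  simpa [unaryHeader] using h

/-- For `y = (c, p, s)`: the string `q` does not halt under the code `c` within `s` steps, or it is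
equal to `p`, or it is incomparable with `p` in the prefix order. -/
def NoConflict (q : List Bool) (y : Code × List Bool × ℕ) : Prop :=
  Code.evaln y.2.2 y.1 (encode q) = none ∨ q = y.2.1 ∨
    ¬ (q.take y.2.1.length = y.2.1 ∨ y.2.1.take q.length = q)

instance (q : List Bool) (y : Code × List Bool × ℕ) : Decidable (NoConflict q y) := by
  unfold NoConflict; infer_instance

/-- The strings with code below `s`. -/
def stringsBelow (s : ℕ) : List (List Bool) :=
  (List.range s).filterMap (fun n => (decode n : Option (List Bool)))

/-- One step of the search which defines the optimal machine: on input `w`, check that `w` consists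
of the unary code of `c` followed by `p`, and that `p` does not conflict with other programs for
`c`; if so, return the output of `c` on `p`, if it is available after `s` steps. -/
def optimalStep (w : List Bool) (y : Code × List Bool × ℕ) : Option (List Bool) :=
  if w = unaryHeader (encode y.1) ++ y.2.1 ∧ ∀ q ∈ stringsBelow y.2.2, NoConflict q y then
    (Code.evaln y.2.2 y.1 (encode y.2.1)).bind (fun n => (decode n : Option (List Bool)))
  else none

/-- A concrete optimal prefix-free machine. -/
def optimalMachine (w : List Bool) : Part (List Bool) :=
  Nat.rfindOpt fun n => (decode n : Option (Code × List Bool × ℕ)).bind (optimalStep w)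

theorem primrec_unaryHeader : Primrec unaryHeader :=
  Primrec.list_append.comp
    (Primrec.list_map Primrec.list_range (Primrec.const true).to₂) (Primrec.const [false])

theorem primrecRel_noConflict : PrimrecRel NoConflict := by
  have hq : Primrec fun z : List Bool × (Code × List Bool × ℕ) => z.1 := Primrec.fst
  have hc : Primrec fun z : List Bool × (Code × List Bool × ℕ) => z.2.1 :=
    Primrec.fst.comp Primrec.snd
  have hp : Primrec fun z : List Bool × (Code × List Bool × ℕ) => z.2.2.1 :=
    Primrec.fst.comp (Primrec.snd.comp Primrec.snd)
  have hs : Primrec fun z : List Bool × (Code × List Bool × ℕ) => z.2.2.2 :=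
    Primrec.snd.comp (Primrec.snd.comp Primrec.snd)
  have he : Primrec fun z : List Bool × (Code × List Bool × ℕ) =>
      Code.evaln z.2.2.2 z.2.1 (encode z.1) :=
    Code.primrec_evaln.comp (Primrec.pair (Primrec.pair hs hc) (Primrec.encode.comp hq))
  have h1 : PrimrecPred fun z : List Bool × (Code × List Bool × ℕ) =>
      Code.evaln z.2.2.2 z.2.1 (encode z.1) = none := Primrec.eq.comp he (Primrec.const none)
  have h2 : PrimrecPred fun z : List Bool × (Code × List Bool × ℕ) => z.1 = z.2.2.1 :=
    Primrec.eq.comp hq hp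
  have h3 : PrimrecPred fun z : List Bool × (Code × List Bool × ℕ) =>
      z.1.take z.2.2.1.length = z.2.2.1 :=
    Primrec.eq.comp (Primrec.list_take.comp (Primrec.list_length.comp hp) hq) hp
  have h4 : PrimrecPred fun z : List Bool × (Code × List Bool × ℕ) =>
      z.2.2.1.take z.1.length = z.1 :=
    Primrec.eq.comp (Primrec.list_take.comp (Primrec.list_length.comp hq) hp) hq
  exact h1.or (h2.or (h3.or h4).not)

theorem primrec_stringsBelow : Primrec stringsBelow :=
  Primrec.listFilterMap Primrec.list_range (Primrec.decode.comp Primrec.snd).to₂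

theorem mem_stringsBelow {q : List Bool} {s : ℕ} (h : encode q < s) : q ∈ stringsBelow s := by
  simp only [stringsBelow, List.mem_filterMap, List.mem_range]
  exact ⟨encode q, h, encodek q⟩

theorem primrec_optimalStep : Primrec₂ optimalStep := by
  have hw : Primrec fun z : List Bool × (Code × List Bool × ℕ) => z.1 := Primrec.fst
  have hc : Primrec fun z : List Bool × (Code × List Bool × ℕ) => z.2.1 :=
    Primrec.fst.comp Primrec.snd
  have hp : Primrec fun z : List Bool × (Code × List Bool × ℕ) => z.2.2.1 :=
    Primrec.fst.comp (Primrec.snd.comp Primrec.snd)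
  have hs : Primrec fun z : List Bool × (Code × List Bool × ℕ) => z.2.2.2 :=
    Primrec.snd.comp (Primrec.snd.comp Primrec.snd)
  have h1 : PrimrecPred fun z : List Bool × (Code × List Bool × ℕ) =>
      z.1 = unaryHeader (encode z.2.1) ++ z.2.2.1 :=
    Primrec.eq.comp hw
      (Primrec.list_append.comp (primrec_unaryHeader.comp (Primrec.encode.comp hc)) hp)
  have h2 : PrimrecPred fun z : List Bool × (Code × List Bool × ℕ) =>
      ∀ q ∈ stringsBelow z.2.2.2, NoConflict q z.2 :=
    (PrimrecRel.forall_mem_list primrecRel_noConflict).comp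
      (primrec_stringsBelow.comp hs) Primrec.snd
  have h3 : Primrec fun z : List Bool × (Code × List Bool × ℕ) =>
      (Code.evaln z.2.2.2 z.2.1 (encode z.2.2.1)).bind
        (fun n => (decode n : Option (List Bool))) :=
    Primrec.option_bind
      (Code.primrec_evaln.comp (Primrec.pair (Primrec.pair hs hc) (Primrec.encode.comp hp)))
      (Primrec.decode.comp Primrec.snd).to₂
  exact Primrec.ite (h1.and h2) h3 (Primrec.const none)

theorem partrec_optimalMachine : Partrec optimalMachine := by
  refine Partrec.rfindOpt (Primrec₂.to_comp ?_)
  exact Primrec.option_bind (Primrec.decode.comp Primrec.snd)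
    (primrec_optimalStep.comp (Primrec.fst.comp Primrec.fst) Primrec.snd).to₂

theorem optimalStep_of_dom {w : List Bool} (h : (optimalMachine w).Dom) :
    ∃ (c : Code) (p : List Bool) (s : ℕ), w = unaryHeader (encode c) ++ p ∧
      (∀ q ∈ stringsBelow s, NoConflict q (c, p, s)) ∧ ∃ n, n ∈ Code.evaln s c (encode p) := by
  obtain ⟨n, a, ha⟩ := Nat.rfindOpt_dom.1 h
  obtain ⟨⟨c, p, s⟩, -, h2⟩ := Option.bind_eq_some_iff.1 ha
  unfold optimalStep at h2
  split_ifs at h2 with hif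
  obtain ⟨m, hm, -⟩ := Option.bind_eq_some_iff.1 h2
  exact ⟨c, p, s, hif.1, hif.2, m, hm⟩

theorem isPrefixFreeMachine_optimalMachine : IsPrefixFreeMachine optimalMachine := by
  refine ⟨partrec_optimalMachine, ?_⟩
  intro w w' hw hw' hpre
  obtain ⟨c, p, s, rfl, hacc, n, hn⟩ := optimalStep_of_dom hw
  obtain ⟨c', p', s', rfl, hacc', n', hn'⟩ := optimalStep_of_dom hw'
  obtain ⟨hcc, hpp⟩ := unaryHeader_prefix _ _ _ _ hpre
  obtain rfl : c = c' := encode_injective hcc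
  congr 1
  rcases le_total s s' with hs | hs
  · have h := Code.evaln_mono hs hn
    rcases hacc' p (mem_stringsBelow (Code.evaln_bound h)) with h0 | h0 | h0
    · simp [h0] at h
    · exact h0
    · exact absurd (Or.inr (List.prefix_iff_eq_take.1 hpp).symm) h0
  · have h := Code.evaln_mono hs hn'
    rcases hacc p' (mem_stringsBelow (Code.evaln_bound h)) with h0 | h0 | h0
    · simp [h0] at h
    · exact h0.symm
    · exact absurd (Or.inl (List.prefix_iff_eq_take.1 hpp).symm) h0

theorem exists_code_optimalMachine (M : List Bool →. List Bool) (hM : IsPrefixFreeMachine M) :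
    ∃ c : Code, ∀ (p a : List Bool), a ∈ M p → a ∈ optimalMachine (unaryHeader (encode c) ++ p) := by
  obtain ⟨c, hc⟩ := Code.exists_code.1 hM.partrec
  have hev : ∀ (p : List Bool) (n : ℕ), n ∈ Code.eval c (encode p) ↔ ∃ a ∈ M p, encode a = n := by
    intro p n
    rw [hc]
    simp
  refine ⟨c, fun p a ha => ?_⟩
  obtain ⟨s, hs⟩ := Code.evaln_complete.1 ((hev p (encode a)).2 ⟨a, ha, rfl⟩)
  have hdomp : (M p).Dom := Part.dom_iff_mem.2 ⟨a, ha⟩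
  have hstep : optimalStep (unaryHeader (encode c) ++ p) (c, p, s) = some a := by
    unfold optimalStep
    rw [if_pos]
    · rw [Option.mem_def.1 hs]; simp
    · refine ⟨rfl, fun q _ => ?_⟩
      by_cases h0 : Code.evaln s c (encode q) = none
      · exact Or.inl h0
      obtain ⟨m, hm⟩ := Option.ne_none_iff_exists'.1 h0
      obtain ⟨b, hb, -⟩ := (hev q m).1 (Code.evaln_sound hm)
      have hdomq : (M q).Dom := Part.dom_iff_mem.2 ⟨b, hb⟩
      right
      by_cases hcmp : q.take p.length = p ∨ p.take q.length = q
      · left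
        rcases hcmp with h | h
        · exact (hM.prefixFree p q hdomp hdomq (List.prefix_iff_eq_take.2 h.symm)).symm
        · exact hM.prefixFree q p hdomq hdomp (List.prefix_iff_eq_take.2 h.symm)
      · exact Or.inr hcmp
  have hdom : (optimalMachine (unaryHeader (encode c) ++ p)).Dom :=
    Nat.rfindOpt_dom.2 ⟨encode (c, p, s), a, by simp only [encodek]; exact hstep⟩
  obtain ⟨b, hb⟩ := Part.dom_iff_mem.1 hdom
  obtain ⟨n, hn⟩ := Nat.rfindOpt_spec hb
  obtain ⟨⟨c', p', s'⟩, -, h2⟩ := Option.bind_eq_some_iff.1 hn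
  unfold optimalStep at h2
  split_ifs at h2 with hif
  have heq : unaryHeader (encode c) ++ p = unaryHeader (encode c') ++ p' := hif.1
  obtain ⟨hcc, -⟩ := unaryHeader_prefix (encode c) (encode c') p p'
    ⟨[], by rw [List.append_nil, heq]⟩
  obtain rfl : c = c' := encode_injective hcc
  obtain rfl : p = p' := List.append_cancel_left heq
  obtain ⟨m, hm, hmb⟩ := Option.bind_eq_some_iff.1 h2
  obtain ⟨a', ha', hm'⟩ := (hev p m).1 (Code.evaln_sound hm)
  obtain rfl : a' = a := Part.mem_unique ha' ha
  rw [← hm', encodek] at hmb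
  rw [Option.some.inj hmb]
  exact hb

theorem isOptimalMachine_optimalMachine : IsOptimalMachine optimalMachine := by
  refine ⟨isPrefixFreeMachine_optimalMachine, fun M hM => ?_⟩
  obtain ⟨c, hc⟩ := exists_code_optimalMachine M hM
  refine ⟨encode c + 1, fun a => ?_⟩
  unfold machineComplexity
  rw [ENat.iInf_add]
  refine le_iInf fun p => ?_
  by_cases h : a ∈ M p
  · refine (iInf₂_le (unaryHeader (encode c) ++ p) (hc p a h)).trans ?_
    rw [iInf_pos h, List.length_append, unaryHeader_length, add_comm]
    push_cast
    exact le_rfl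
  · simp [h]

end OptimalMachine

/-- The (prefix-free) Kolmogorov complexity of a finite binary string. -/
noncomputable def kolmogorovComplexity (a : List Bool) : ℕ∞ :=
  machineComplexity optimalMachine a

/-- The initial segment of length `n` of an infinite binary string. -/
def initialSegment (α : ℕ → Bool) (n : ℕ) : List Bool :=
  List.ofFn fun j : Fin n => α j

/-- The set of Kolmogorov-Chaitin complex strings: those `α` for which there is `k` such that the
initial segment of length `n` has complexity at least `n - k`, for all `n`. -/
def KC : Set (ℕ → Bool) :=
  {α | ∃ k : ℕ, ∀ n : ℕ, (n : ℕ∞) ≤ kolmogorovComplexity (initialSegment α n) + k}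

/-- The Rademacher sequence: `1` or `-1` according to the `n`-th symbol of `α`. -/
def rademacher (α : ℕ → Bool) (n : ℕ) : ℝ :=
  if α n then 1 else -1

/-! ## Computable reals -/

/-- A sequence of reals is computable if there is a computable double sequence of rationals
`r n k = (a n k - b n k) / (d n k + 1)` with `|x n - r n k| ≤ 2 ^ (-k)` for all `n` and `k`. -/
def IsComputableSeq (x : ℕ → ℝ) : Prop :=
  ∃ a b d : ℕ → ℕ → ℕ, Computable₂ a ∧ Computable₂ b ∧ Computable₂ d ∧
    ∀ n k : ℕ, |x n - ((a n k : ℝ) - (b n k : ℝ)) / ((d n k : ℝ) + 1)| ≤ 1 / 2 ^ k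

/-- A real is computable if it is effectively the limit of a computable sequence of rationals. -/
def IsComputableReal (t : ℝ) : Prop :=
  ∃ a b d : ℕ → ℕ, Computable a ∧ Computable b ∧ Computable d ∧
    ∀ k : ℕ, |t - ((a k : ℝ) - (b k : ℝ)) / ((d k : ℝ) + 1)| ≤ 1 / 2 ^ k

/-- A computable sequence of reals is square computable if the sum of its squares is finite and the
partial sums converge to it effectively. -/
structure IsSquareComputable (x : ℕ → ℝ) : Prop where
  isComputableSeq : IsComputableSeq x
  summable : Summable fun k => x k ^ 2
  effective : ∃ N : ℕ → ℕ, Computable N ∧ ∀ m : ℕ, 0 < m →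
    |(∑' k, x k ^ 2) - ∑ k ∈ Finset.range (N m + 1), x k ^ 2| < 1 / (m : ℝ)

/-!
The terms `c n = x n * cos (2 π n t + φ n)` form a computable sequence of reals which is dominated
by `x`, so that the theorem is an instance of `tendsto_sum_rademacher_mul`: a random series with
computable coefficients converges for the signs of a complex string if the coefficients are
dominated by a square computable sequence.

The convergence of `∑ x n ^ 2` being effective, the indices can be divided computably into blocks
such that the sum of squares over the `j`-th block is of the order `16 ^ (-j)`
(`exists_computable_blocks`). By Kolmogorov's maximal inequality (`countP_exceeds_stoppedSum`), for
all but a fraction `4 ^ (-j)` of the sign patterns the partial sums within the block are at most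
`2 ^ (-j)` in absolute value. When the coefficients are rounded to dyadic rationals, the exceptional
patterns can be listed by a machine. A pattern of length `L` which is in the `j`-th list is
described by `j` in unary and its position in the list, that is by about `L - j` bits. As the
length of the second part is determined by `j`, such descriptions are prefix-free, so a complex
string is exceptional for finitely many blocks only (`eventually_initialSegment_notMem`). From then
on the oscillation over the `j`-th block is `O(2 ^ (-j))`, and the partial sums form a Cauchy
sequence (`tendsto_of_block_bound`).

The maximal inequality is proved for sums which stop once they exceed the threshold: these are
computed by a fold over the list of coefficients, and the second moment of the stopped sum is
bounded by induction on that list.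

The computability of `c` follows from closure properties of computable families of reals
(`ComputableFamily`), with Leibniz' series for `π` and the Taylor series for the cosine.
-/

/-! ### Computable functions with values in the natural numbers -/

section ComputableNat
variable {β : Type*} [Primcodable β]

theorem Computable.natAdd {f g : β → ℕ} (hf : Computable f) (hg : Computable g) :
    Computable fun x => f x + g x := (Primrec.nat_add.to_comp).comp hf hg

theorem Computable.natSub {f g : β → ℕ} (hf : Computable f) (hg : Computable g) :
    Computable fun x => f x - g x := (Primrec.nat_sub.to_comp).comp hf hg

theorem Computable.natMul {f g : β → ℕ} (hf : Computable f) (hg : Computable g) :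
    Computable fun x => f x * g x := (Primrec.nat_mul.to_comp).comp hf hg

theorem Computable.natDiv {f g : β → ℕ} (hf : Computable f) (hg : Computable g) :
    Computable fun x => f x / g x := (Primrec.nat_div.to_comp).comp hf hg

theorem Computable.natPow {f g : β → ℕ} (hf : Computable f) (hg : Computable g) :
    Computable fun x => f x ^ g x := by
  refine (Computable.nat_rec (h := fun x (p : ℕ × ℕ) => p.2 * f x) hg (Computable.const 1)
    ?_).of_eq fun x => ?_
  · exact Computable.natMul (Computable.snd.comp Computable.snd) (hf.comp Computable.fst)
  · induction g x with
    | zero => rfl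
    | succ n ih => simp only [ih, pow_succ]

theorem Computable.natFactorial {f : β → ℕ} (hf : Computable f) :
    Computable fun x => (f x).factorial := by
  refine (Computable.nat_rec (h := fun _ (p : ℕ × ℕ) => (p.1 + 1) * p.2) hf (Computable.const 1)
    ?_).of_eq fun x => ?_
  · have h1 : Computable fun x : β × ℕ × ℕ => x.2.1 := Computable.fst.comp Computable.snd
    exact (h1.natAdd (Computable.const 1)).natMul (Computable.snd.comp Computable.snd)
  · induction f x with
    | zero => rfl
    | succ n ih => simp only [ih, Nat.factorial_succ]

theorem Computable.natSum {f : β → ℕ → ℕ} {g : β → ℕ} (hf : Computable₂ f) (hg : Computable g) :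
    Computable fun x => ∑ i ∈ Finset.range (g x), f x i := by
  refine (Computable.nat_rec (h := fun x (p : ℕ × ℕ) => p.2 + f x p.1) hg (Computable.const 0)
    ?_).of_eq fun x => ?_
  · exact (Computable.snd.comp Computable.snd).natAdd
      (hf.comp Computable.fst (Computable.fst.comp Computable.snd))
  · induction g x with
    | zero => rfl
    | succ n ih => simp only [ih, Finset.sum_range_succ]

end ComputableNat

/-! ### Computable families of reals -/

/-- A family of reals is computable if its members have rational approximations which depend
computably on the index and on the precision. For the index type `ℕ` this is `IsComputableSeq`. -/
def ComputableFamily {β : Type*} [Primcodable β] (f : β → ℝ) : Prop :=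
  ∃ a b d : β → ℕ → ℕ, Computable₂ a ∧ Computable₂ b ∧ Computable₂ d ∧
    ∀ x k, |f x - ((a x k : ℝ) - (b x k : ℝ)) / ((d x k : ℝ) + 1)| ≤ 1 / 2 ^ k

namespace ComputableFamily

variable {β γ : Type*} [Primcodable β] [Primcodable γ]

theorem of_real {t : ℝ} (ht : IsComputableReal t) : ComputableFamily fun _ : β => t := by
  obtain ⟨a, b, d, ha, hb, hd, h⟩ := ht
  exact ⟨fun _ => a, fun _ => b, fun _ => d, ha.comp Computable.snd, hb.comp Computable.snd,
    hd.comp Computable.snd, fun _ => h⟩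

theorem comp {f : β → ℝ} (hf : ComputableFamily f) {g : γ → β} (hg : Computable g) :
    ComputableFamily fun x => f (g x) := by
  obtain ⟨a, b, d, ha, hb, hd, h⟩ := hf
  exact ⟨fun x => a (g x), fun x => b (g x), fun x => d (g x),
    ha.comp (hg.comp Computable.fst) Computable.snd,
    hb.comp (hg.comp Computable.fst) Computable.snd,
    hd.comp (hg.comp Computable.fst) Computable.snd, fun x => h (g x)⟩

theorem of_approx {f : β → ℝ} {a b d : β → ℕ → ℕ} (ha : Computable₂ a) (hb : Computable₂ b)
    (hd : Computable₂ d) (hpos : ∀ x k, 0 < d x k)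
    (h : ∀ x k, |f x - ((a x k : ℝ) - b x k) / d x k| ≤ 1 / 2 ^ k) : ComputableFamily f := by
  refine ⟨a, b, fun x k => d x k - 1, ha, hb, Computable.natSub hd (Computable.const 1),
    fun x k => ?_⟩
  have : ((d x k - 1 : ℕ) : ℝ) + 1 = d x k := by
    rw [Nat.cast_sub (hpos x k)]; simp
  simp only [this]
  exact h x k

theorem natDiv {a d : β → ℕ} (ha : Computable a) (hd : Computable d) (hpos : ∀ x, 0 < d x) :
    ComputableFamily fun x => (a x : ℝ) / d x :=
  of_approx (a := fun x _ => a x) (b := fun _ _ => 0) (d := fun x _ => d x)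
    (ha.comp Computable.fst) (Computable.const 0) (hd.comp Computable.fst) (fun x _ => hpos x)
    fun x k => by simp

theorem natCast {a : β → ℕ} (ha : Computable a) : ComputableFamily fun x => (a x : ℝ) := by
  simpa using natDiv ha (Computable.const 1) fun _ => one_pos

theorem neg {f : β → ℝ} (hf : ComputableFamily f) : ComputableFamily fun x => -f x := by
  obtain ⟨a, b, d, ha, hb, hd, h⟩ := hf
  refine ⟨b, a, d, hb, ha, hd, fun x k => ?_⟩
  rw [← abs_neg]
  convert h x k using 2
  ring

/-- The limit of a computable double family is computable if the convergence is effective. -/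
theorem of_limit {f : β → ℝ} {g : β → ℕ → ℝ}
    (hg : ComputableFamily fun p : β × ℕ => g p.1 p.2)
    (h : ∀ x k, |f x - g x k| ≤ 1 / 2 ^ k) : ComputableFamily f := by
  obtain ⟨a, b, d, ha, hb, hd, h'⟩ := hg
  have hs : Computable fun p : β × ℕ => p.2 + 1 := Computable.natAdd Computable.snd (.const 1)
  have hp : Computable fun p : β × ℕ => (p.1, p.2 + 1) := Computable.pair Computable.fst hs
  refine ⟨fun x k => a (x, k + 1) (k + 1), fun x k => b (x, k + 1) (k + 1),
    fun x k => d (x, k + 1) (k + 1), ha.comp hp hs, hb.comp hp hs, hd.comp hp hs, fun x k => ?_⟩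
  refine (abs_sub_le _ (g x (k + 1)) _).trans ((add_le_add (h x (k + 1))
    (h' (x, k + 1) (k + 1))).trans (le_of_eq ?_))
  field_simp
  ring

/-- Rounding makes the denominators independent of the index. -/
theorem exists_dyadic {f : β → ℝ} (hf : ComputableFamily f) :
    ∃ a b : β → ℕ → ℕ, Computable₂ a ∧ Computable₂ b ∧
      ∀ x k, |f x - ((a x k : ℝ) - b x k) / 2 ^ (k + 1)| ≤ 1 / 2 ^ k := by
  obtain ⟨a, b, d, ha, hb, hd, h⟩ := hf
  have hs : Computable fun p : β × ℕ => p.2 + 1 := Computable.natAdd Computable.snd (.const 1)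
  have h2 : Computable fun p : β × ℕ => 2 ^ (p.2 + 1) := (Computable.const 2).natPow hs
  have hd' : Computable fun p : β × ℕ => d p.1 (p.2 + 1) + 1 :=
    (hd.comp Computable.fst hs).natAdd (.const 1)
  refine ⟨fun x k => a x (k + 1) * 2 ^ (k + 1) / (d x (k + 1) + 1),
    fun x k => b x (k + 1) * 2 ^ (k + 1) / (d x (k + 1) + 1),
    ((ha.comp Computable.fst hs).natMul h2).natDiv hd',
    ((hb.comp Computable.fst hs).natMul h2).natDiv hd', fun x k => ?_⟩
  have h1 := h x (k + 1)
  dsimp only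
  generalize a x (k + 1) = a, b x (k + 1) = b, d x (k + 1) = d at *
  set A := a * 2 ^ (k + 1) / (d + 1) with hA
  set B := b * 2 ^ (k + 1) / (d + 1) with hB
  have floor : ∀ m : ℕ, ((m * 2 ^ (k + 1) / (d + 1) : ℕ) : ℝ) ≤ m * 2 ^ (k + 1) / ((d : ℝ) + 1) ∧
      (m : ℝ) * 2 ^ (k + 1) / ((d : ℝ) + 1) ≤ ((m * 2 ^ (k + 1) / (d + 1) : ℕ) : ℝ) + 1 := by
    intro m
    have e : (m : ℝ) * 2 ^ (k + 1) / ((d : ℝ) + 1) =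
        ((m * 2 ^ (k + 1) : ℕ) : ℝ) / ((d + 1 : ℕ) : ℝ) := by
      push_cast; rfl
    rw [e]
    refine ⟨Nat.cast_div_le, ?_⟩
    rw [div_le_iff₀ (by positivity)]
    exact_mod_cast ((Nat.div_add_mod (m * 2 ^ (k + 1)) (d + 1)).symm.le.trans (by
      rw [mul_comm, add_mul, one_mul]
      exact add_le_add_right (Nat.mod_lt _ d.succ_pos).le _))
  obtain ⟨a1, a2⟩ := floor a
  obtain ⟨b1, b2⟩ := floor b
  rw [← hA] at a1 a2
  rw [← hB] at b1 b2
  have h3 : |((a : ℝ) - b) / (d + 1) - ((A : ℝ) - B) / 2 ^ (k + 1)| ≤ 1 / 2 ^ (k + 1) := by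
    have e : ((a : ℝ) - b) / (d + 1) - ((A : ℝ) - B) / 2 ^ (k + 1) =
        ((a * 2 ^ (k + 1) / ((d : ℝ) + 1) - A) - (b * 2 ^ (k + 1) / ((d : ℝ) + 1) - B))
          / 2 ^ (k + 1) := by
      field_simp
      ring
    rw [e, abs_div, abs_of_pos (by positivity : (0 : ℝ) < 2 ^ (k + 1))]
    gcongr
    rw [abs_le]
    constructor <;> linarith
  refine (abs_sub_le _ _ _).trans ((add_le_add h1 h3).trans (le_of_eq ?_))
  field_simp
  ring

theorem sum {f : β → ℕ → ℝ} (hf : ComputableFamily fun p : β × ℕ => f p.1 p.2) {n : β → ℕ}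
    (hn : Computable n) : ComputableFamily fun x => ∑ i ∈ Finset.range (n x), f x i := by
  obtain ⟨a, b, ha, hb, h⟩ := hf.exists_dyadic
  have hk : Computable fun p : β × ℕ => p.2 + n p.1 :=
    Computable.snd.natAdd (hn.comp Computable.fst)
  have hq : Computable fun q : (β × ℕ) × ℕ => (q.1.1, q.2) :=
    (Computable.fst.comp Computable.fst).pair Computable.snd
  -- The extra precision `n x` makes up for the number of terms.
  refine of_approx (a := fun x k => ∑ i ∈ Finset.range (n x), a (x, i) (k + n x))
    (b := fun x k => ∑ i ∈ Finset.range (n x), b (x, i) (k + n x))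
    (d := fun x k => 2 ^ (k + n x + 1)) ?_ ?_ ?_ (fun x k => by positivity) fun x k => ?_
  · exact Computable.natSum (f := fun (p : β × ℕ) i => a (p.1, i) (p.2 + n p.1))
      (ha.comp hq (hk.comp Computable.fst)) (hn.comp Computable.fst)
  · exact Computable.natSum (f := fun (p : β × ℕ) i => b (p.1, i) (p.2 + n p.1))
      (hb.comp hq (hk.comp Computable.fst)) (hn.comp Computable.fst)
  · exact (Computable.const 2).natPow (hk.natAdd (.const 1))
  · push_cast
    rw [← Finset.sum_sub_distrib, Finset.sum_div, ← Finset.sum_sub_distrib]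
    refine (Finset.abs_sum_le_sum_abs _ _).trans
      ((Finset.sum_le_sum fun i _ => h (x, i) (k + n x)).trans ?_)
    rw [Finset.sum_const, Finset.card_range, nsmul_eq_mul, pow_add]
    have : (n x : ℝ) ≤ 2 ^ n x := by exact_mod_cast Nat.lt_two_pow_self.le
    rw [mul_one_div, div_le_div_iff₀ (by positivity) (by positivity)]
    nlinarith [pow_pos (two_pos : (0 : ℝ) < 2) k]

theorem add {f g : β → ℝ} (hf : ComputableFamily f) (hg : ComputableFamily g) :
    ComputableFamily fun x => f x + g x := by
  obtain ⟨a, b, ha, hb, h⟩ := hf.exists_dyadic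
  obtain ⟨a', b', ha', hb', h'⟩ := hg.exists_dyadic
  have hs : Computable fun p : β × ℕ => p.2 + 1 := Computable.natAdd Computable.snd (.const 1)
  have sh : ∀ {u : β → ℕ → ℕ}, Computable₂ u → Computable fun p : β × ℕ => u p.1 (p.2 + 1) :=
    fun hu => hu.comp Computable.fst hs
  refine of_approx (a := fun x k => a x (k + 1) + a' x (k + 1))
    (b := fun x k => b x (k + 1) + b' x (k + 1)) (d := fun x k => 2 ^ (k + 1 + 1))
    ((sh ha).natAdd (sh ha')) ((sh hb).natAdd (sh hb'))
    ((Computable.const 2).natPow (hs.natAdd (.const 1))) (fun x k => by positivity) fun x k => ?_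
  have e := (abs_add_le _ _).trans (add_le_add (h x (k + 1)) (h' x (k + 1)))
  have e2 : (1 : ℝ) / 2 ^ (k + 1) + 1 / 2 ^ (k + 1) = 1 / 2 ^ k := by
    field_simp; ring
  rw [e2] at e
  refine le_trans (le_of_eq (congrArg abs ?_)) e
  push_cast
  ring

theorem sub {f g : β → ℝ} (hf : ComputableFamily f) (hg : ComputableFamily g) :
    ComputableFamily fun x => f x - g x := by
  simpa only [sub_eq_add_neg] using hf.add hg.neg

theorem mul {f g : β → ℝ} (hf : ComputableFamily f) (hg : ComputableFamily g) :
    ComputableFamily fun x => f x * g x := by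
  obtain ⟨a, b, d, ha, hb, hd, h⟩ := hf
  obtain ⟨a', b', d', ha', hb', hd', h'⟩ := hg
  -- The precision for the factors exceeds the desired one by a bound for the size of the factors.
  let e : β → ℕ → ℕ := fun x k => k + (a x 0 + b x 0 + (a' x 0 + b' x 0) + 3)
  have he : Computable fun p : β × ℕ => e p.1 p.2 := by
    have z : ∀ {u : β → ℕ → ℕ}, Computable₂ u → Computable fun p : β × ℕ => u p.1 0 :=
      fun hu => hu.comp Computable.fst (.const 0)
    exact Computable.snd.natAdd ((((z ha).natAdd (z hb)).natAdd
      ((z ha').natAdd (z hb'))).natAdd (.const 3))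
  have sh : ∀ {u : β → ℕ → ℕ}, Computable₂ u → Computable fun p : β × ℕ => u p.1 (e p.1 p.2) :=
    fun hu => hu.comp Computable.fst he
  refine of_approx
    (a := fun x k => a x (e x k) * a' x (e x k) + b x (e x k) * b' x (e x k))
    (b := fun x k => a x (e x k) * b' x (e x k) + b x (e x k) * a' x (e x k))
    (d := fun x k => (d x (e x k) + 1) * (d' x (e x k) + 1))
    (((sh ha).natMul (sh ha')).natAdd ((sh hb).natMul (sh hb')))
    (((sh ha).natMul (sh hb')).natAdd ((sh hb).natMul (sh ha')))
    (((sh hd).natAdd (.const 1)).natMul ((sh hd').natAdd (.const 1)))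
    (fun x k => by positivity) fun x k => ?_
  have bound : ∀ (y : ℝ) (a b d : ℕ), |y - ((a : ℝ) - b) / (d + 1)| ≤ 1 / 2 ^ 0 →
      |y| ≤ a + b + 1 := by
    intro y a b d hy
    have h1 : |((a : ℝ) - b) / (d + 1)| ≤ a + b := by
      rw [abs_div, abs_of_pos (by positivity : (0 : ℝ) < d + 1)]
      refine (div_le_self (abs_nonneg _) (by simp)).trans ?_
      rw [abs_le]
      constructor <;>
        linarith [(Nat.cast_nonneg a : (0 : ℝ) ≤ a), (Nat.cast_nonneg b : (0 : ℝ) ≤ b)]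
    have h2 := abs_sub_abs_le_abs_sub y (((a : ℝ) - b) / (d + 1))
    simp only [pow_zero, div_one] at hy
    linarith
  have hF := bound _ _ _ _ (h x 0)
  have hG := bound _ _ _ _ (h' x 0)
  have h1 := h x (e x k)
  have h1' := h' x (e x k)
  set δ : ℝ := 1 / 2 ^ e x k with hδ
  have hδ0 : 0 < δ := by positivity
  have hδ1 : δ ≤ 1 := by
    rw [hδ, div_le_one (by positivity)]
    exact one_le_pow₀ one_le_two
  have hM : ((a x 0 : ℝ) + b x 0 + (a' x 0 + b' x 0) + 3) * δ ≤ 1 / 2 ^ k := by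
    have hM : ((a x 0 + b x 0 + (a' x 0 + b' x 0) + 3 : ℕ) : ℝ) ≤
        2 ^ (a x 0 + b x 0 + (a' x 0 + b' x 0) + 3) := by
      exact_mod_cast Nat.lt_two_pow_self.le
    rw [hδ, mul_one_div, div_le_div_iff₀ (by positivity) (by positivity)]
    simp only [e, pow_add _ k]
    push_cast at hM
    nlinarith [pow_pos (two_pos : (0 : ℝ) < 2) k]
  have hprod : (((a x (e x k) * a' x (e x k) + b x (e x k) * b' x (e x k) : ℕ) : ℝ) -
      ((a x (e x k) * b' x (e x k) + b x (e x k) * a' x (e x k) : ℕ) : ℝ)) /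
      (((d x (e x k) + 1) * (d' x (e x k) + 1) : ℕ) : ℝ) =
      (((a x (e x k) : ℝ) - b x (e x k)) / (d x (e x k) + 1)) *
      (((a' x (e x k) : ℝ) - b' x (e x k)) / (d' x (e x k) + 1)) := by
    push_cast
    field_simp
    ring
  rw [hprod]
  set F := ((a x (e x k) : ℝ) - b x (e x k)) / (d x (e x k) + 1)
  set G := ((a' x (e x k) : ℝ) - b' x (e x k)) / (d' x (e x k) + 1)
  have hG' : |G| ≤ |g x| + δ := by
    have := abs_sub_abs_le_abs_sub G (g x)
    rw [abs_sub_comm] at this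
    linarith
  calc |f x * g x - F * G| = |f x * (g x - G) + G * (f x - F)| := by ring_nf
    _ ≤ |f x| * |g x - G| + |G| * |f x - F| := by
      rw [← abs_mul, ← abs_mul]; exact abs_add_le _ _
    _ ≤ (a x 0 + b x 0 + 1) * δ + ((a' x 0 + b' x 0 + 1) + 1) * δ := by
      gcongr
      linarith
    _ ≤ 1 / 2 ^ k := by linarith

/-- Leibniz' alternating series gives the approximations. -/
theorem pi : ComputableFamily fun _ : β => Real.pi := by
  have key : ∀ k : ℕ, |Real.pi - 4 * ∑ i ∈ Finset.range (2 ^ (k + 1)),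
      (1 / ((4 * i + 1 : ℕ) : ℝ) - 1 / ((4 * i + 3 : ℕ) : ℝ))| ≤ 1 / 2 ^ k := by
    intro k
    have hanti : Antitone fun i : ℕ => 1 / (2 * (i : ℝ) + 1) := by
      intro i j hij
      have : (i : ℝ) ≤ j := by exact_mod_cast hij
      dsimp only
      gcongr
    have ht : Tendsto (fun n => ∑ i ∈ Finset.range n, (-1 : ℝ) ^ i * (1 / (2 * (i : ℝ) + 1))) atTop
        (𝓝 (Real.pi / 4)) := by
      simpa only [mul_one_div] using Real.tendsto_sum_pi_div_four
    have h1 := hanti.alternating_series_le_tendsto ht (2 ^ (k + 1))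
    have h2 := hanti.tendsto_le_alternating_series ht (2 ^ (k + 1))
    rw [Finset.sum_range_succ] at h2
    have hsum : ∀ n : ℕ, ∑ i ∈ Finset.range (2 * n), (-1 : ℝ) ^ i * (1 / (2 * (i : ℝ) + 1)) =
        ∑ i ∈ Finset.range n, (1 / ((4 * i + 1 : ℕ) : ℝ) - 1 / ((4 * i + 3 : ℕ) : ℝ)) := by
      intro n
      induction n with
      | zero => simp
      | succ n ih =>
        rw [mul_add, mul_one, Finset.sum_range_succ, Finset.sum_range_succ, ih,
          Finset.sum_range_succ, pow_succ, pow_mul]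
        push_cast
        simp only [even_two, Even.neg_pow, one_pow]
        ring
    rw [hsum] at h1 h2
    rw [pow_mul] at h2
    simp only [even_two, Even.neg_pow, one_pow, one_mul] at h2
    push_cast at h1 h2 ⊢
    have h3 : 4 * (1 / (2 * (2 * (2 : ℝ) ^ (k + 1)) + 1)) ≤ 1 / 2 ^ k := by
      rw [mul_one_div, div_le_div_iff₀ (by positivity) (by positivity), pow_succ]
      linarith [pow_pos (two_pos : (0 : ℝ) < 2) k]
    rw [abs_le]
    constructor
    · have : (0 : ℝ) ≤ 1 / 2 ^ k := by positivity
      linarith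
    · linarith
  refine of_limit (g := fun _ k => 4 * ∑ i ∈ Finset.range (2 ^ (k + 1)),
      (1 / ((4 * i + 1 : ℕ) : ℝ) - 1 / ((4 * i + 3 : ℕ) : ℝ))) ?_ fun _ k => key k
  have h4 : ∀ c : ℕ, Computable fun q : (β × ℕ) × ℕ => 4 * q.2 + c := fun c =>
    ((Computable.const 4).natMul Computable.snd).natAdd (.const c)
  have hrat : ∀ c : ℕ, 0 < c →
      ComputableFamily fun q : (β × ℕ) × ℕ => 1 / ((4 * q.2 + c : ℕ) : ℝ) := fun c hc => by
    simpa using natDiv (Computable.const 1) (h4 c) (fun q => by positivity)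
  have h2 : Computable fun p : β × ℕ => 2 ^ (p.2 + 1) :=
    (Computable.const 2).natPow (Computable.snd.natAdd (.const 1))
  refine ComputableFamily.mul ?_
    (ComputableFamily.sum ((hrat 1 one_pos).sub (hrat 3 (by norm_num))) h2)
  simpa using natCast (β := β × ℕ) (Computable.const 4)

end ComputableFamily

/-! ### The cosine of a computable family -/

/-- The error of a Taylor polynomial of the cosine, as the real part of the one of `exp (r * I)`;
two consecutive terms of the series are taken together. -/
theorem cos_taylor_bound (r : ℝ) (m : ℕ) (hr : |r| / (4 * m + 1 : ℕ) ≤ 1 / 2) :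
    |Real.cos r - ∑ i ∈ Finset.range m,
      (r ^ (4 * i) / ((4 * i).factorial : ℝ) - r ^ (4 * i + 2) / ((4 * i + 2).factorial : ℝ))| ≤
      |r| ^ (4 * m) / ((4 * m).factorial : ℝ) * 2 := by
  have hn : ‖(r : ℂ) * Complex.I‖ = |r| := by simp
  have h := Complex.exp_bound' (x := r * Complex.I) (n := 4 * m) (by rw [hn]; exact_mod_cast hr)
  rw [hn] at h
  refine le_trans ?_ h
  refine le_trans (le_of_eq ?_) (Complex.abs_re_le_norm _)
  congr 1
  rw [Complex.sub_re, Complex.exp_ofReal_mul_I_re]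
  congr 1
  have term : ∀ n c : ℕ, ((r : ℂ) * Complex.I) ^ (4 * n + c) / ((4 * n + c).factorial : ℂ) =
      ((r ^ (4 * n + c) / ((4 * n + c).factorial : ℝ) : ℝ) : ℂ) * Complex.I ^ c := by
    intro n c
    rw [mul_pow, pow_add Complex.I, pow_mul Complex.I, Complex.I_pow_four, one_pow, one_mul]
    push_cast
    ring
  clear h hr
  induction m with
  | zero => simp
  | succ m ih =>
    have t0 := term m 0
    rw [add_zero] at t0
    rw [Finset.sum_range_succ, ih, mul_add, mul_one, Finset.sum_range_succ _ (4 * m + 3),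
      Finset.sum_range_succ _ (4 * m + 2), Finset.sum_range_succ _ (4 * m + 1),
      Finset.sum_range_succ _ (4 * m), t0, term m 1, term m 2, term m 3]
    simp only [Complex.add_re, Complex.re_ofReal_mul, pow_zero, pow_one, Complex.I_sq,
      Complex.I_pow_three, Complex.neg_re, Complex.I_re, Complex.one_re]
    ring

/-- The number of terms of the Taylor series of the cosine which give the precision `2 ^ (-k)` for
arguments up to `n`. -/
theorem cos_taylor_error (r : ℝ) (n k : ℕ) (hr : |r| ≤ n) :
    |Real.cos r - ∑ i ∈ Finset.range (n ^ 2 + n + k + 1),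
      (r ^ (4 * i) / ((4 * i).factorial : ℝ) - r ^ (4 * i + 2) / ((4 * i + 2).factorial : ℝ))| ≤
      1 / 2 ^ k := by
  refine (cos_taylor_bound r _ ?_).trans ?_
  · rw [div_le_iff₀ (by positivity)]
    push_cast
    nlinarith [(Nat.cast_nonneg n : (0 : ℝ) ≤ n), (Nat.cast_nonneg k : (0 : ℝ) ≤ k)]
  · obtain ⟨s, hs, hm⟩ : ∃ s, 2 * n ^ 2 + (k + 1) ≤ s ∧ 4 * (n ^ 2 + n + k + 1) = 2 * n + s :=
      ⟨4 * n ^ 2 + 2 * n + 4 * k + 4, by nlinarith, by ring⟩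
    rw [hm]
    -- `(2 n + s)! ≥ (2 n + 1) ^ s` dominates `n ^ (2 n + s)` since `n ^ (2 n) ≤ 2 ^ (2 n ^ 2)`.
    have h1 : (2 * n + 1) ^ s ≤ (2 * n + s).factorial :=
      (Nat.le_mul_of_pos_left _ (Nat.factorial_pos _)).trans Nat.factorial_mul_pow_le_factorial
    have h2 : n ^ (2 * n + s) * 2 ^ (k + 1) ≤ (2 * n + s).factorial := by
      calc n ^ (2 * n + s) * 2 ^ (k + 1) ≤ (2 ^ (2 * n ^ 2) * n ^ s) * 2 ^ (k + 1) := by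
            rw [pow_add]
            refine Nat.mul_le_mul_right _ (Nat.mul_le_mul_right _ ?_)
            calc n ^ (2 * n) ≤ (2 ^ n) ^ (2 * n) := by
                  gcongr
                  exact Nat.lt_two_pow_self.le
              _ = 2 ^ (2 * n ^ 2) := by rw [← pow_mul]; ring_nf
        _ = 2 ^ (2 * n ^ 2 + (k + 1)) * n ^ s := by ring
        _ ≤ 2 ^ s * n ^ s := by
            gcongr
            norm_num
        _ = (2 * n) ^ s := by rw [mul_pow]
        _ ≤ (2 * n + 1) ^ s := by gcongr; exact Nat.le_succ _
        _ ≤ _ := h1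
    have h3 : |r| ^ (2 * n + s) * 2 ^ (k + 1) ≤ ((2 * n + s).factorial : ℝ) :=
      
      le_trans (b := (n : ℝ) ^ (2 * n + s) * 2 ^ (k + 1)) (by gcongr) (by exact_mod_cast h2)
    rw [div_mul_eq_mul_div, div_le_div_iff₀ (by positivity) (by positivity)]
    rw [pow_succ] at h3
    linarith

namespace ComputableFamily

variable {β : Type*} [Primcodable β]

theorem cos_natDiv {n d : β → ℕ} (hn : Computable n) (hd : Computable d) :
    ComputableFamily fun x => Real.cos ((n x : ℝ) / (d x + 1 : ℕ)) := by
  refine of_limit (g := fun p k => ∑ i ∈ Finset.range (n p ^ 2 + n p + k + 1),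
      (((n p : ℝ) / (d p + 1 : ℕ)) ^ (4 * i) / ((4 * i).factorial : ℝ) -
        ((n p : ℝ) / (d p + 1 : ℕ)) ^ (4 * i + 2) / ((4 * i + 2).factorial : ℝ))) ?_ fun p k => ?_
  · have term : ∀ c : ℕ, ComputableFamily fun q : (β × ℕ) × ℕ =>
        ((n q.1.1 : ℝ) / (d q.1.1 + 1 : ℕ)) ^ (4 * q.2 + c) / ((4 * q.2 + c).factorial : ℝ) := by
      intro c
      have hp : Computable fun q : (β × ℕ) × ℕ => n q.1.1 :=
        hn.comp (Computable.fst.comp Computable.fst)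
      have hq : Computable fun q : (β × ℕ) × ℕ => d q.1.1 + 1 :=
        (hd.comp (Computable.fst.comp Computable.fst)).natAdd (.const 1)
      have he : Computable fun q : (β × ℕ) × ℕ => 4 * q.2 + c :=
        ((Computable.const 4).natMul Computable.snd).natAdd (.const c)
      have := natDiv (hp.natPow he) ((hq.natPow he).natMul he.natFactorial) fun q => by positivity
      refine cast (congrArg ComputableFamily (funext fun q => ?_)) this
      push_cast
      rw [div_pow, div_div]
    refine sum ((term 0).sub (term 2)) ?_
    have hp : Computable fun q : β × ℕ => n q.1 := hn.comp Computable.fst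
    exact (((hp.natPow (.const 2)).natAdd hp).natAdd Computable.snd).natAdd (.const 1)
  · refine cos_taylor_error _ _ _ ?_
    rw [abs_of_nonneg (by positivity)]
    exact div_le_self (by positivity) (by simp)

theorem cos {f : β → ℝ} (hf : ComputableFamily f) : ComputableFamily fun x => Real.cos (f x) := by
  obtain ⟨a, b, d, ha, hb, hd, h⟩ := hf
  -- The cosine is even, so that the absolute value of the rational approximation suffices.
  refine of_limit (g := fun x k =>
    Real.cos (((a x k - b x k + (b x k - a x k) : ℕ) : ℝ) / (d x k + 1 : ℕ))) ?_ fun x k => ?_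
  · exact cos_natDiv (n := fun p : β × ℕ => a p.1 p.2 - b p.1 p.2 + (b p.1 p.2 - a p.1 p.2))
      (d := fun p => d p.1 p.2) ((Computable.natSub ha hb).natAdd (Computable.natSub hb ha)) hd
  · have e : Real.cos (((a x k - b x k + (b x k - a x k) : ℕ) : ℝ) / (d x k + 1 : ℕ)) =
        Real.cos (((a x k : ℝ) - b x k) / (d x k + 1)) := by
      rcases le_total (a x k) (b x k) with hab | hab
      · rw [← Real.cos_neg (((a x k : ℝ) - b x k) / _), Nat.sub_eq_zero_of_le hab]
        push_cast [hab]
        congr 1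
        ring
      · rw [Nat.sub_eq_zero_of_le hab]
        push_cast [hab]
        congr 1
        ring
    rw [e]
    exact (Real.abs_cos_sub_cos_le _ _).trans (h x k)

end ComputableFamily

theorem computableFamily_mul_cos {x φ : ℕ → ℝ} (hx : IsComputableSeq x) (hφ : IsComputableSeq φ)
    {t : ℝ} (ht : IsComputableReal t) :
    ComputableFamily fun n : ℕ => x n * Real.cos (2 * Real.pi * n * t + φ n) := by
  have h2 : ComputableFamily fun _ : ℕ => (2 : ℝ) := by
    simpa using ComputableFamily.natCast (β := ℕ) (Computable.const 2)
  have hn : ComputableFamily fun n : ℕ => (n : ℝ) := ComputableFamily.natCast Computable.id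
  exact ComputableFamily.mul hx
    ((((h2.mul .pi).mul hn).mul (.of_real ht)).add hφ).cos

/-! ### Effective tests and complex strings -/

/-- The binary strings of length `n`. -/
def allStrings : ℕ → List (List Bool)
  | 0 => [[]]
  | n + 1 => (allStrings n).map (List.cons true) ++ (allStrings n).map (List.cons false)

theorem length_allStrings (n : ℕ) : (allStrings n).length = 2 ^ n := by
  induction n with
  | zero => rfl
  | succ n ih => simp [allStrings, ih, pow_succ, mul_two]

theorem mem_allStrings {n : ℕ} {a : List Bool} : a ∈ allStrings n ↔ a.length = n := by
  induction n generalizing a with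
  | zero => simp [allStrings]
  | succ n ih =>
    rcases a with - | ⟨_ | _, a⟩ <;> simp [allStrings, ih]

theorem nodup_allStrings (n : ℕ) : (allStrings n).Nodup := by
  induction n with
  | zero => simp [allStrings]
  | succ n ih =>
    refine List.Nodup.append (ih.map List.cons_injective) (ih.map List.cons_injective) ?_
    intro a h1 h2
    simp only [List.mem_map] at h1 h2
    obtain ⟨b, -, rfl⟩ := h1
    obtain ⟨c, -, h⟩ := h2
    simp at h

theorem primrec_allStrings : Primrec allStrings := by
  refine (Primrec.nat_rec₁ (f := fun _ l => l.map (List.cons true) ++ l.map (List.cons false))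
    [[]] ?_).of_eq fun n => ?_
  · have h : ∀ b : Bool, Primrec fun p : ℕ × List (List Bool) => p.2.map (List.cons b) := fun b =>
      Primrec.list_map Primrec.snd (Primrec.list_cons.comp (Primrec.const b) Primrec.snd).to₂
    exact Primrec.list_append.comp (h true) (h false)
  · induction n with
    | zero => rfl
    | succ n ih => simp only [ih, allStrings]

theorem idxOf_false_unaryHeader (j : ℕ) (p : List Bool) :
    (unaryHeader j ++ p).idxOf false = j := by
  have h : ∀ j : ℕ, (List.replicate j true ++ false :: p).idxOf false = j := by
    intro j
    induction j with
    | zero => simp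
    | succ j ih => simp [List.replicate_succ, ih]
  simpa [unaryHeader] using h j

/-- The machine which reads `j` in unary and then a string `p` of length `L j - 2 * j`, whose
position among all strings of this length is the position of the output in the list `H j`. -/
def indexMachine (L : ℕ → ℕ) (H : ℕ → List (List Bool)) (w : List Bool) : Part (List Bool) :=
  ((if w = unaryHeader (w.idxOf false) ++ w.drop (w.idxOf false + 1) ∧
      (w.drop (w.idxOf false + 1)).length = L (w.idxOf false) - 2 * w.idxOf false then
    (H (w.idxOf false))[(allStrings (w.drop (w.idxOf false + 1)).length).idxOf
      (w.drop (w.idxOf false + 1))]?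
  else none : Option (List Bool)) : Part (List Bool))

theorem partrec_indexMachine {L : ℕ → ℕ} {H : ℕ → List (List Bool)} (hL : Computable L)
    (hH : Computable H) : Partrec (indexMachine L H) := by
  -- Everything is primitive recursive in the triple of the input, the length and the list.
  have hw : Primrec fun z : List Bool × ℕ × List (List Bool) => z.1 := Primrec.fst
  have hl : Primrec fun z : List Bool × ℕ × List (List Bool) => z.2.1 :=
    Primrec.fst.comp Primrec.snd
  have hh : Primrec fun z : List Bool × ℕ × List (List Bool) => z.2.2 :=
    Primrec.snd.comp Primrec.snd
  have hj : Primrec fun z : List Bool × ℕ × List (List Bool) => z.1.idxOf false :=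
    Primrec.list_idxOf.comp (Primrec.const false) hw
  have hp : Primrec fun z : List Bool × ℕ × List (List Bool) => z.1.drop (z.1.idxOf false + 1) :=
    Primrec.list_drop.comp (Primrec.succ.comp hj) hw
  have hc1 : PrimrecPred fun z : List Bool × ℕ × List (List Bool) =>
      z.1 = unaryHeader (z.1.idxOf false) ++ z.1.drop (z.1.idxOf false + 1) :=
    Primrec.eq.comp hw (Primrec.list_append.comp (primrec_unaryHeader.comp hj) hp)
  have hc2 : PrimrecPred fun z : List Bool × ℕ × List (List Bool) =>
      (z.1.drop (z.1.idxOf false + 1)).length = z.2.1 - 2 * z.1.idxOf false :=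
    Primrec.eq.comp (Primrec.list_length.comp hp)
      (Primrec.nat_sub.comp hl (Primrec.nat_mul.comp (Primrec.const 2) hj))
  have hidx : Primrec₂ (List.idxOf : List Bool → List (List Bool) → ℕ) := by
    convert Primrec.list_idxOf (α := List Bool) using 1
    rw [lawful_beq_subsingleton List.instBEq instBEqOfDecidableEq]
  have ho := Primrec.list_getElem?.comp hh (hidx.comp hp
    (primrec_allStrings.comp (Primrec.list_length.comp hp)))
  have hf := Primrec.ite (hc1.and hc2) ho (Primrec.const none)
  have hj' : Computable fun w : List Bool => w.idxOf false :=
    (Primrec.list_idxOf.comp (Primrec.const false) Primrec.id).to_comp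
  exact Computable.ofOption
    (hf.to_comp.comp (Computable.id.pair ((hL.comp hj').pair (hH.comp hj'))))

theorem indexMachine_dom {L : ℕ → ℕ} {H : ℕ → List (List Bool)} {w : List Bool}
    (h : (indexMachine L H w).Dom) :
    ∃ (j : ℕ) (p : List Bool), w = unaryHeader j ++ p ∧ p.length = L j - 2 * j := by
  unfold indexMachine at h
  split_ifs at h with hc
  · exact ⟨_, _, hc⟩
  · simp at h

theorem isPrefixFreeMachine_indexMachine {L : ℕ → ℕ} {H : ℕ → List (List Bool)}
    (hL : Computable L) (hH : Computable H) : IsPrefixFreeMachine (indexMachine L H) := by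
  refine ⟨partrec_indexMachine hL hH, fun w w' hw hw' hpre => ?_⟩
  obtain ⟨j, p, rfl, hp⟩ := indexMachine_dom hw
  obtain ⟨j', p', rfl, hp'⟩ := indexMachine_dom hw'
  obtain ⟨rfl, hpp⟩ := unaryHeader_prefix _ _ _ _ hpre
  rw [hpp.eq_of_length (hp.trans hp'.symm)]

theorem indexMachine_complexity {L : ℕ → ℕ} {H : ℕ → List (List Bool)} {j : ℕ}
    (hlen : (H j).length ≤ 2 ^ (L j - 2 * j)) {a : List Bool} (ha : a ∈ H j) :
    machineComplexity (indexMachine L H) a ≤ ((j + 1 + (L j - 2 * j) : ℕ) : ℕ∞) := by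
  obtain ⟨i, hi, rfl⟩ := List.getElem_of_mem ha
  have hi' : i < (allStrings (L j - 2 * j)).length := by
    rw [length_allStrings]
    exact hi.trans_le hlen
  set p := (allStrings (L j - 2 * j))[i] with hp
  have hpl : p.length = L j - 2 * j := mem_allStrings.1 (List.getElem_mem hi')
  have hmem : (H j)[i] ∈ indexMachine L H (unaryHeader j ++ p) := by
    have hd : (unaryHeader j ++ p).drop (j + 1) = p := by
      rw [← unaryHeader_length j, List.drop_left]
    unfold indexMachine
    rw [idxOf_false_unaryHeader, hd, if_pos ⟨rfl, hpl⟩, hpl, hp,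
      (nodup_allStrings _).idxOf_getElem i hi', List.getElem?_eq_getElem hi]
    exact Part.mem_some _
  refine (iInf₂_le (unaryHeader j ++ p) hmem).trans ?_
  rw [List.length_append, unaryHeader_length, hpl]

/-- A computable test which keeps, at level `j`, at most a fraction `4 ^ (-j)` of the strings of
length `L j` catches the initial segments of a complex string at finitely many levels only. -/
theorem eventually_initialSegment_notMem {L : ℕ → ℕ} {H : ℕ → List (List Bool)}
    (hL : Computable L) (hH : Computable H) (hLj : ∀ j, 2 * j ≤ L j)
    (hlen : ∀ j, (H j).length ≤ 2 ^ (L j - 2 * j)) {α : ℕ → Bool} (hα : α ∈ KC) :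
    ∃ J, ∀ j ≥ J, initialSegment α (L j) ∉ H j := by
  obtain ⟨k, hk⟩ := hα
  obtain ⟨c, hc⟩ := isOptimalMachine_optimalMachine.optimal _
    (isPrefixFreeMachine_indexMachine hL hH)
  -- A string in `H j` has complexity at most `L j - j + 1 + c`, and at least `L j - k`.
  refine ⟨k + c + 2, fun j hj hmem => ?_⟩
  have h : ((L j : ℕ) : ℕ∞) ≤ ((j + 1 + (L j - 2 * j) + c + k : ℕ) : ℕ∞) := by
    refine (hk (L j)).trans ?_
    push_cast
    gcongr
    refine (hc _).trans ?_
    gcongr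
    exact_mod_cast indexMachine_complexity (hlen j) hmem
  have h' : L j ≤ j + 1 + (L j - 2 * j) + c + k := by exact_mod_cast h
  have := hLj j
  omega

/-! ### Stopped signed sums and the maximal inequality -/

/-- A pair of natural numbers stands for the integer which is the difference of its components. The
predicate says that the absolute value of this integer is larger than `T`. -/
def Exceeds (T : ℕ) (u : ℕ × ℕ) : Prop :=
  T < u.1 - u.2 + (u.2 - u.1)

instance (T : ℕ) (u : ℕ × ℕ) : Decidable (Exceeds T u) := by
  unfold Exceeds; infer_instance

theorem exceeds_iff {T : ℕ} {u : ℕ × ℕ} : Exceeds T u ↔ (T : ℝ) < |(u.1 : ℝ) - u.2| := by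
  have h : |(u.1 : ℝ) - u.2| = ((u.1 - u.2 + (u.2 - u.1) : ℕ) : ℝ) := by
    rcases le_total u.1 u.2 with h | h
    · rw [Nat.sub_eq_zero_of_le h, abs_sub_comm, abs_of_nonneg (by simpa using h)]
      push_cast [h]
      ring
    · rw [Nat.sub_eq_zero_of_le h, abs_of_nonneg (by simpa using h)]
      push_cast [h]
      ring
  rw [h, Nat.cast_lt, Exceeds]

theorem sq_le_of_exceeds {T : ℕ} {u : ℕ × ℕ} (h : Exceeds T u) :
    (T : ℝ) ^ 2 ≤ ((u.1 : ℝ) - u.2) ^ 2 :=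
  sq_le_sq.2 ((Nat.abs_cast T).trans_le (exceeds_iff.1 h).le)

/-- One step of a signed sum which stops once it exceeds `T`: the state consists of the sum, as a
difference of natural numbers, and of the signs which have not been used yet. -/
def stoppedStep (T : ℕ) (s : (ℕ × ℕ) × List Bool) (v : ℕ × ℕ) : (ℕ × ℕ) × List Bool :=
  (if Exceeds T s.1 then s.1
    else if s.2.headI = true then (s.1.1 + v.1, s.1.2 + v.2) else (s.1.1 + v.2, s.1.2 + v.1),
    s.2.tail)

/-- The sum of the terms of `w` with the signs `a`, stopped once it exceeds `T`. -/
def stoppedSum (T : ℕ) (w : List (ℕ × ℕ)) (u : ℕ × ℕ) (a : List Bool) : ℕ × ℕ :=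
  (w.foldl (stoppedStep T) (u, a)).1

/-- The maximal inequality of Kolmogorov, in the form of Chebyshev's inequality for the stopped
sums. The induction conditions on the first sign, for which
`(r + v) ^ 2 + (r - v) ^ 2 = 2 * (r ^ 2 + v ^ 2)`. -/
theorem countP_exceeds_stoppedSum (T : ℕ) (w : List (ℕ × ℕ)) (u : ℕ × ℕ) :
    ((allStrings w.length).countP (fun a => Exceeds T (stoppedSum T w u a)) : ℝ) * (T : ℝ) ^ 2 ≤
      2 ^ w.length * (((u.1 : ℝ) - u.2) ^ 2 + (w.map fun v => ((v.1 : ℝ) - v.2) ^ 2).sum) := by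
  induction w generalizing u with
  | nil =>
    by_cases h : Exceeds T u
    · have := sq_le_of_exceeds h
      simpa [allStrings, stoppedSum, h] using this
    · simp [allStrings, stoppedSum, h]
      positivity
  | cons v w ih =>
    have hS : 0 ≤ (w.map fun v => ((v.1 : ℝ) - v.2) ^ 2).sum :=
      List.sum_nonneg (by simp only [List.mem_map]; rintro _ ⟨v, -, rfl⟩; positivity)
    by_cases h : Exceeds T u
    · have h1 := sq_le_of_exceeds h
      have h2 : ((allStrings (v :: w).length).countP
          (fun a => Exceeds T (stoppedSum T (v :: w) u a)) : ℝ) ≤ 2 ^ (v :: w).length := by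
        exact_mod_cast List.countP_le_length.trans (length_allStrings _).le
      refine mul_le_mul h2 ?_ (by positivity) (by positivity)
      rw [List.map_cons, List.sum_cons]
      nlinarith [sq_nonneg ((v.1 : ℝ) - v.2)]
    · have hc : (allStrings (v :: w).length).countP
          (fun a => Exceeds T (stoppedSum T (v :: w) u a)) =
          (allStrings w.length).countP
            (fun a => Exceeds T (stoppedSum T w (u.1 + v.1, u.2 + v.2) a)) +
          (allStrings w.length).countP
            (fun a => Exceeds T (stoppedSum T w (u.1 + v.2, u.2 + v.1) a)) := by
        rw [List.length_cons, allStrings, List.countP_append, List.countP_map, List.countP_map]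
        simp [Function.comp_def, stoppedSum, stoppedStep, h]
        congr
      have h1 := ih (u.1 + v.1, u.2 + v.2)
      have h2 := ih (u.1 + v.2, u.2 + v.1)
      rw [hc, Nat.cast_add, add_mul, List.map_cons, List.sum_cons, List.length_cons, pow_succ]
      refine (add_le_add h1 h2).trans (le_of_eq ?_)
      push_cast
      ring

theorem length_initialSegment (α : ℕ → Bool) (n : ℕ) : (initialSegment α n).length = n := by
  simp [initialSegment]

/-- If the stopped sum does not exceed the threshold in the end, it has never been stopped. -/
theorem abs_sum_le_of_not_exceeds {T : ℕ} {v : ℕ → ℕ × ℕ} {L : ℕ} {α : ℕ → Bool}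
    (h : ¬ Exceeds T (stoppedSum T ((List.range L).map v) (0, 0) (initialSegment α L))) {m : ℕ}
    (hm : m ≤ L) :
    |∑ i ∈ Finset.range m, rademacher α i * (((v i).1 : ℝ) - (v i).2)| ≤ T := by
  let st : ℕ → (ℕ × ℕ) × List Bool := fun m =>
    ((List.range m).map v).foldl (stoppedStep T) ((0, 0), initialSegment α L)
  have st_succ : ∀ m, st (m + 1) = stoppedStep T (st m) (v m) := fun m => by
    simp only [st, List.range_succ, List.map_append, List.foldl_append, List.map_cons,
      List.map_nil, List.foldl_cons, List.foldl_nil]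
  have signs : ∀ m, (st m).2 = (initialSegment α L).drop m := by
    intro m
    induction m with
    | zero => rfl
    | succ m ih => rw [st_succ, stoppedStep, ih, List.tail_drop]
  have running : ∀ m ≤ L, ¬ Exceeds T (st m).1 := by
    intro m hm
    induction hm using Nat.decreasingInduction with
    | self => exact h
    | of_succ m _ ih =>
      intro he
      apply ih
      rw [st_succ, stoppedStep, if_pos he]
      exact he
  have value : ∀ m ≤ L, (((st m).1.1 : ℝ) - (st m).1.2) =
      ∑ i ∈ Finset.range m, rademacher α i * (((v i).1 : ℝ) - (v i).2) := by
    intro m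
    induction m with
    | zero => intro _; simp [st]
    | succ m ih =>
      intro hm
      have hlt : m < (initialSegment α L).length := by rw [length_initialSegment]; exact hm
      have head : (st m).2.headI = α m := by
        rw [signs, List.drop_eq_getElem_cons hlt]
        simp [initialSegment]
      rw [Finset.sum_range_succ, ← ih (Nat.le_of_succ_le hm), st_succ, stoppedStep,
        if_neg (running m (Nat.le_of_succ_le hm)), head, rademacher]
      split_ifs <;> push_cast <;> ring
  rw [← value m hm]
  exact not_lt.1 fun h' => running m hm (exceeds_iff.2 h')

/-- The sign patterns of length `L` for which the stopped sum exceeds the threshold. -/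
def exceedingStrings (T : ℕ) (w : List (ℕ × ℕ)) (L : ℕ) : List (List Bool) :=
  (allStrings L).filter fun a => Exceeds T (stoppedSum T w (0, 0) a)

theorem primrecRel_exceeds : PrimrecRel Exceeds := by
  have h1 : Primrec fun p : ℕ × ℕ × ℕ => p.2.1 := Primrec.fst.comp Primrec.snd
  have h2 : Primrec fun p : ℕ × ℕ × ℕ => p.2.2 := Primrec.snd.comp Primrec.snd
  exact Primrec.nat_lt.comp Primrec.fst
    (Primrec.nat_add.comp (Primrec.nat_sub.comp h1 h2) (Primrec.nat_sub.comp h2 h1))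

theorem primrec_stoppedStep :
    Primrec fun p : ℕ × ((ℕ × ℕ) × List Bool) × ℕ × ℕ => stoppedStep p.1 p.2.1 p.2.2 := by
  have hs : Primrec fun p : ℕ × ((ℕ × ℕ) × List Bool) × ℕ × ℕ => p.2.1 :=
    Primrec.fst.comp Primrec.snd
  have hv : Primrec fun p : ℕ × ((ℕ × ℕ) × List Bool) × ℕ × ℕ => p.2.2 :=
    Primrec.snd.comp Primrec.snd
  have hu : Primrec fun p : ℕ × ((ℕ × ℕ) × List Bool) × ℕ × ℕ => p.2.1.1 := Primrec.fst.comp hs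
  have ha : Primrec fun p : ℕ × ((ℕ × ℕ) × List Bool) × ℕ × ℕ => p.2.1.2 := Primrec.snd.comp hs
  have hu1 := Primrec.fst.comp hu
  have hu2 := Primrec.snd.comp hu
  have hv1 := Primrec.fst.comp hv
  have hv2 := Primrec.snd.comp hv
  refine Primrec.pair (Primrec.ite (primrecRel_exceeds.comp Primrec.fst hu) hu
    (Primrec.ite (Primrec.eq.comp (Primrec.list_headI.comp ha) (Primrec.const true)) ?_ ?_))
    (Primrec.list_tail.comp ha)
  · exact Primrec.pair (Primrec.nat_add.comp hu1 hv1) (Primrec.nat_add.comp hu2 hv2)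
  · exact Primrec.pair (Primrec.nat_add.comp hu1 hv2) (Primrec.nat_add.comp hu2 hv1)

theorem primrec_exceedingStrings :
    Primrec fun p : ℕ × List (ℕ × ℕ) × ℕ => exceedingStrings p.1 p.2.1 p.2.2 := by
  have hT : Primrec fun z : List Bool × ℕ × List (ℕ × ℕ) => z.2.1 := Primrec.fst.comp Primrec.snd
  have hw : Primrec fun z : List Bool × ℕ × List (ℕ × ℕ) => z.2.2 := Primrec.snd.comp Primrec.snd
  have hsum : Primrec fun z : List Bool × ℕ × List (ℕ × ℕ) =>
      stoppedSum z.2.1 z.2.2 (0, 0) z.1 := by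
    refine Primrec.fst.comp (Primrec.list_foldl
      (h := fun (z : List Bool × ℕ × List (ℕ × ℕ)) p => stoppedStep z.2.1 p.1 p.2) hw
      (Primrec.pair (Primrec.const (0, 0)) Primrec.fst) ?_)
    exact primrec_stoppedStep.comp (Primrec.pair (hT.comp Primrec.fst) Primrec.snd)
  have hR : PrimrecRel fun (a : List Bool) (y : ℕ × List (ℕ × ℕ)) =>
      Exceeds y.1 (stoppedSum y.1 y.2 (0, 0) a) := primrecRel_exceeds.comp hT hsum
  exact hR.listFilter.comp
    (primrec_allStrings.comp (Primrec.snd.comp Primrec.snd))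
    (Primrec.pair Primrec.fst (Primrec.fst.comp Primrec.snd))

theorem length_exceedingStrings (T : ℕ) (v : ℕ → ℕ × ℕ) (L : ℕ) :
    ((exceedingStrings T ((List.range L).map v) L).length : ℝ) * (T : ℝ) ^ 2 ≤
      2 ^ L * ∑ i ∈ Finset.range L, (((v i).1 : ℝ) - (v i).2) ^ 2 := by
  have h := countP_exceeds_stoppedSum T ((List.range L).map v) (0, 0)
  have hs : ∀ (f : ℕ → ℝ) (n : ℕ), ((List.range n).map f).sum = ∑ i ∈ Finset.range n, f i := by
    intro f n
    induction n with
    | zero => rfl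
    | succ n ih => simp [List.range_succ, Finset.sum_range_succ, ih]
  rw [List.length_map, List.length_range, List.map_map, hs] at h
  rw [exceedingStrings, ← List.countP_eq_length_filter]
  simpa using h

theorem Computable.listMapRange {β σ : Type*} [Primcodable β] [Primcodable σ] {f : β → ℕ → σ}
    {n : β → ℕ} (hf : Computable₂ f) (hn : Computable n) :
    Computable fun x => (List.range (n x)).map (f x) := by
  refine (Computable.nat_rec (h := fun x (p : ℕ × List σ) => p.2 ++ [f x p.1]) hn
    (Computable.const []) ?_).of_eq fun x => ?_
  · exact Computable.list_concat.comp (Computable.snd.comp Computable.snd)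
      (hf.comp Computable.fst (Computable.fst.comp Computable.snd))
  · induction n x with
    | zero => rfl
    | succ n ih => simp only [ih, List.range_succ, List.map_append, List.map_cons, List.map_nil]

/-! ### Convergence of signed series -/

/-- Each block of a series is controlled by twice the bound for the increments at its start, and
these bounds decrease geometrically. -/
theorem tendsto_of_block_bound {F : ℕ → ℝ} {s : ℕ → ℕ} (hs : StrictMono s) {J : ℕ}
    (h : ∀ j ≥ J, ∀ m, s j ≤ m → m ≤ s (j + 1) → |F m - F (s j)| ≤ 2 * (1 / 2) ^ j) :
    ∃ S, Tendsto F atTop (𝓝 S) := by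
  have key : ∀ i, ∀ j ≥ J, ∀ m, s j ≤ m → m ≤ s (j + i) → |F m - F (s j)| ≤ 4 * (1 / 2) ^ j := by
    intro i
    induction i with
    | zero =>
      intro j _ m h1 h2
      rw [add_zero] at h2
      rw [le_antisymm h2 h1, sub_self, abs_zero]
      positivity
    | succ i ih =>
      intro j hj m h1 h2
      rcases le_total m (s (j + 1)) with hm | hm
      · refine (h j hj m h1 hm).trans ?_
        gcongr
        norm_num
      · have e1 := ih (j + 1) (by omega) m hm (h2.trans_eq (by congr 1; omega))
        have e2 := h j hj (s (j + 1)) (hs (Nat.lt_succ_self j)).le le_rfl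
        refine (abs_sub_le _ (F (s (j + 1))) _).trans ((add_le_add e1 e2).trans (le_of_eq ?_))
        ring
  refine cauchySeq_tendsto_of_complete (Metric.cauchySeq_iff'.2 fun ε hε => ?_)
  obtain ⟨n, hn⟩ := exists_pow_lt_of_lt_one (div_pos hε four_pos) (by norm_num : (1 / 2 : ℝ) < 1)
  refine ⟨s (max n J), fun m hm => ?_⟩
  have hle := key m (max n J) (le_max_right _ _) m hm
    ((Nat.le_add_left _ _).trans (hs.id_le _))
  have hpow : (1 / 2 : ℝ) ^ max n J ≤ (1 / 2) ^ n :=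
    pow_le_pow_of_le_one (by norm_num) (by norm_num) (le_max_left _ _)
  rw [Real.dist_eq]
  linarith

/-- The coefficients `(a i, b i)` from the index `s` on, preceded by zeros. -/
def blockCoeff (s : ℕ) (a b : ℕ → ℕ) (i : ℕ) : ℕ × ℕ :=
  bif decide (i < s) then (0, 0) else (a i, b i)

theorem blockCoeff_of_lt {s : ℕ} {a b : ℕ → ℕ} {i : ℕ} (h : i < s) :
    blockCoeff s a b i = (0, 0) := by
  simp [blockCoeff, h]

theorem blockCoeff_of_le {s : ℕ} {a b : ℕ → ℕ} {i : ℕ} (h : s ≤ i) :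
    blockCoeff s a b i = (a i, b i) := by
  simp [blockCoeff, not_lt.2 h]

section Block

/- One block of a series with the coefficients `c`, which are known up to an error of `2 ^ (-K)` as
multiples of `2 ^ (-(K + 1))`. The precision `K = L + 2 * j + 1` makes the sum of the errors over
the block small, and the threshold `2 ^ (L + j + 2)` stands for `2 ^ (-j)`. -/
variable {c : ℕ → ℝ} {s L j : ℕ} {a b : ℕ → ℕ}

theorem sum_sq_blockCoeff_le {x : ℕ → ℝ} (hsL : s ≤ L)
    (hab : ∀ i, |c i - ((a i : ℝ) - b i) / 2 ^ (L + 2 * j + 1 + 1)| ≤ 1 / 2 ^ (L + 2 * j + 1))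
    (hcx : ∀ n, |c n| ≤ |x n|) (tail : ∑ i ∈ Finset.Ico s L, x i ^ 2 ≤ 1 / (4 * 16 ^ j)) :
    ∑ i ∈ Finset.range L, (((blockCoeff s a b i).1 : ℝ) - (blockCoeff s a b i).2) ^ 2 ≤
      (2 ^ (L + 2 * j + 1 + 1)) ^ 2 * (1 / 16 ^ j) := by
  have h1 : ∀ i ∈ Finset.Ico s L,
      (((blockCoeff s a b i).1 : ℝ) - (blockCoeff s a b i).2) ^ 2 ≤
      (2 ^ (L + 2 * j + 1 + 1)) ^ 2 * (2 * x i ^ 2 + 2 * (1 / 2 ^ (L + 2 * j + 1)) ^ 2) := by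
    intro i hi
    rw [blockCoeff_of_le (Finset.mem_Ico.1 hi).1]
    have e1 := sq_le_sq.2 ((hab i).trans (le_abs_self _))
    have e2 : c i ^ 2 ≤ x i ^ 2 := sq_le_sq.2 (hcx i)
    set z := ((a i : ℝ) - b i) / 2 ^ (L + 2 * j + 1 + 1) with hz
    have e3 : (a i : ℝ) - b i = 2 ^ (L + 2 * j + 1 + 1) * z := by
      rw [hz]; field_simp
    dsimp only
    rw [e3, mul_pow]
    refine mul_le_mul_of_nonneg_left ?_ (by positivity)
    -- `2 * c ^ 2 + 2 * (c - z) ^ 2 - z ^ 2 = (2 * c - z) ^ 2`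
    nlinarith [sq_nonneg (2 * c i - z)]
  have h0 : ∑ i ∈ Finset.range s,
      (((blockCoeff s a b i).1 : ℝ) - (blockCoeff s a b i).2) ^ 2 = 0 :=
    Finset.sum_eq_zero fun i hi => by simp [blockCoeff_of_lt (Finset.mem_range.1 hi)]
  rw [← Finset.sum_range_add_sum_Ico _ hsL, h0, zero_add]
  refine (Finset.sum_le_sum h1).trans ?_
  rw [← Finset.mul_sum, Finset.sum_add_distrib, ← Finset.mul_sum, Finset.sum_const, Nat.card_Ico,
    nsmul_eq_mul]
  refine mul_le_mul_of_nonneg_left ?_ (by positivity)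
  have h2 : ((L - s : ℕ) : ℝ) ≤ 2 ^ L := by
    exact_mod_cast (Nat.sub_le _ _).trans Nat.lt_two_pow_self.le
  have h3 : ((L - s : ℕ) : ℝ) * (2 * (1 / 2 ^ (L + 2 * j + 1)) ^ 2) ≤ 1 / (2 * 16 ^ j) := by
    have e : (2 : ℝ) * (1 / 2 ^ (L + 2 * j + 1)) ^ 2 = 1 / (2 * (2 ^ L) ^ 2 * 16 ^ j) := by
      have h16 : (16 : ℝ) ^ j = 2 ^ (4 * j) := by rw [pow_mul]; norm_num
      rw [h16]
      field_simp
      ring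
    rw [e, mul_one_div, div_le_div_iff₀ (by positivity) (by positivity)]
    have hone : (1 : ℝ) ≤ 2 ^ L := one_le_pow₀ one_le_two
    have h16 : (0 : ℝ) < 16 ^ j := by positivity
    have : ((L - s : ℕ) : ℝ) ≤ (2 ^ L) ^ 2 := h2.trans (by nlinarith)
    nlinarith
  have e : (1 : ℝ) / 16 ^ j = 2 * (1 / (4 * 16 ^ j)) + 1 / (2 * 16 ^ j) := by
    field_simp
    norm_num
  rw [e]
  linarith

theorem length_exceedingStrings_blockCoeff_le {x : ℕ → ℝ} (hsL : s ≤ L) (hjL : 2 * j ≤ L)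
    (hab : ∀ i, |c i - ((a i : ℝ) - b i) / 2 ^ (L + 2 * j + 1 + 1)| ≤ 1 / 2 ^ (L + 2 * j + 1))
    (hcx : ∀ n, |c n| ≤ |x n|) (tail : ∑ i ∈ Finset.Ico s L, x i ^ 2 ≤ 1 / (4 * 16 ^ j)) :
    (exceedingStrings (2 ^ (L + j + 2)) ((List.range L).map (blockCoeff s a b)) L).length ≤
      2 ^ (L - 2 * j) := by
  have h1 := (length_exceedingStrings (2 ^ (L + j + 2)) (blockCoeff s a b) L).trans
    (mul_le_mul_of_nonneg_left (sum_sq_blockCoeff_le hsL hab hcx tail) (by positivity))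
  have h2 : ((exceedingStrings (2 ^ (L + j + 2))
      ((List.range L).map (blockCoeff s a b)) L).length : ℝ) ≤ 2 ^ (L - 2 * j) := by
    have hT0 : (0 : ℝ) < ((2 ^ (L + j + 2) : ℕ) : ℝ) ^ 2 := by positivity
    refine le_of_mul_le_mul_right (h1.trans (le_of_eq ?_)) hT0
    obtain ⟨l, rfl⟩ := Nat.exists_eq_add_of_le hjL
    have h16 : (16 : ℝ) ^ j = 2 ^ (4 * j) := by rw [pow_mul]; norm_num
    rw [Nat.add_sub_cancel_left, h16]
    push_cast
    field_simp
    ring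
  exact_mod_cast h2

theorem abs_sum_Ico_le_of_notMem_exceedingStrings {m : ℕ} (hsm : s ≤ m) (hmL : m ≤ L)
    (hab : ∀ i, |c i - ((a i : ℝ) - b i) / 2 ^ (L + 2 * j + 1 + 1)| ≤ 1 / 2 ^ (L + 2 * j + 1))
    {α : ℕ → Bool} (hα : initialSegment α L ∉
      exceedingStrings (2 ^ (L + j + 2)) ((List.range L).map (blockCoeff s a b)) L) :
    |∑ i ∈ Finset.Ico s m, rademacher α i * c i| ≤ 2 * (1 / 2) ^ j := by
  have hwalk := abs_sum_le_of_not_exceeds (T := 2 ^ (L + j + 2)) (v := blockCoeff s a b)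
    (α := α) (fun he => hα (by
    simp only [exceedingStrings, List.mem_filter, mem_allStrings, length_initialSegment,
      decide_eq_true he, and_self])) hmL
  have h0 : ∑ i ∈ Finset.range s, rademacher α i *
      (((blockCoeff s a b i).1 : ℝ) - (blockCoeff s a b i).2) = 0 :=
    Finset.sum_eq_zero fun i hi => by simp [blockCoeff_of_lt (Finset.mem_range.1 hi)]
  rw [← Finset.sum_range_add_sum_Ico _ hsm, h0, zero_add] at hwalk
  set R := ∑ i ∈ Finset.Ico s m, rademacher α i *
    (((blockCoeff s a b i).1 : ℝ) - (blockCoeff s a b i).2) with hR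
  have happrox : |∑ i ∈ Finset.Ico s m, rademacher α i * c i - R / 2 ^ (L + 2 * j + 1 + 1)| ≤
      (1 / 2) ^ j := by
    rw [hR, Finset.sum_div, ← Finset.sum_sub_distrib]
    have e : ∀ i ∈ Finset.Ico s m, |rademacher α i * c i - rademacher α i *
        (((blockCoeff s a b i).1 : ℝ) - (blockCoeff s a b i).2) / 2 ^ (L + 2 * j + 1 + 1)| ≤
        1 / 2 ^ (L + 2 * j + 1) := by
      intro i hi
      have hr : |rademacher α i| = 1 := by
        unfold rademacher
        split_ifs <;> simp
      rw [blockCoeff_of_le (Finset.mem_Ico.1 hi).1, mul_div_assoc, ← mul_sub, abs_mul, hr, one_mul]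
      exact hab i
    refine (Finset.abs_sum_le_sum_abs _ _).trans ((Finset.sum_le_sum e).trans ?_)
    rw [Finset.sum_const, Nat.card_Ico, nsmul_eq_mul]
    have h2 : ((m - s : ℕ) : ℝ) ≤ 2 ^ L := by
      exact_mod_cast ((Nat.sub_le _ _).trans hmL).trans Nat.lt_two_pow_self.le
    have h3 : (2 : ℝ) ^ L * 2 ^ j ≤ 2 ^ (L + 2 * j + 1) := by
      rw [← pow_add]
      exact pow_le_pow_right₀ one_le_two (by omega)
    rw [one_div_pow, mul_one_div, div_le_div_iff₀ (by positivity) (by positivity), one_mul]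
    exact (mul_le_mul_of_nonneg_right h2 (by positivity)).trans h3
  have hwalk' : |R / 2 ^ (L + 2 * j + 1 + 1)| ≤ (1 / 2) ^ j := by
    rw [abs_div, abs_of_pos (by positivity : (0 : ℝ) < 2 ^ (L + 2 * j + 1 + 1)),
      div_le_iff₀ (by positivity)]
    refine hwalk.trans (le_of_eq ?_)
    rw [one_div_pow, one_div, eq_inv_mul_iff_mul_eq₀ (by positivity)]
    push_cast
    ring
  have := abs_sub_abs_le_abs_sub (∑ i ∈ Finset.Ico s m, rademacher α i * c i)
    (R / 2 ^ (L + 2 * j + 1 + 1))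
  linarith

end Block

/-- If the squares of the terms of a sequence have an effectively convergent sum, there is a
computable partition into blocks the sums of squares over which decrease like `16 ^ (-j)`. -/
theorem exists_computable_blocks {x : ℕ → ℝ} (hx : IsSquareComputable x) :
    ∃ s : ℕ → ℕ, Computable s ∧ StrictMono s ∧ (∀ j, 2 * j ≤ s j) ∧
      ∀ j, ∑ i ∈ Finset.Ico (s j) (s (j + 1)), x i ^ 2 ≤ 1 / (4 * 16 ^ j) := by
  obtain ⟨-, hsum, N, hN, hNx⟩ := hx
  obtain ⟨s, hs⟩ : ∃ s : ℕ → ℕ, s = fun j => ∑ i ∈ Finset.range (j + 1), (N (4 * 16 ^ i) + 2) :=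
    ⟨_, rfl⟩
  have s_succ : ∀ j, s (j + 1) = s j + (N (4 * 16 ^ (j + 1)) + 2) := fun j => by
    rw [hs]
    exact Finset.sum_range_succ _ _
  have s_mono : StrictMono s := strictMono_nat_of_lt_succ fun j => by rw [s_succ]; omega
  have hNs : ∀ j, N (4 * 16 ^ j) + 1 ≤ s j := by
    intro j
    rcases j with - | j
    · simp [hs]
    · rw [s_succ]; omega
  refine ⟨s, ?_, s_mono, fun j => ?_, fun j => ?_⟩
  · rw [hs]
    refine Computable.natSum (f := fun _ i => N (4 * 16 ^ i) + 2) ?_ Computable.succ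
    exact (hN.comp ((Computable.const 4).natMul ((Computable.const 16).natPow
      Computable.snd))).natAdd (.const 2)
  · induction j with
    | zero => simp
    | succ j ih => rw [s_succ]; omega
  · have h1 := (abs_lt.1 (hNx (4 * 16 ^ j) (by positivity))).2
    have h2 := hsum.sum_le_tsum (Finset.range (s (j + 1))) fun i _ => sq_nonneg (x i)
    have h3 : ∑ i ∈ Finset.range (N (4 * 16 ^ j) + 1), x i ^ 2 ≤
        ∑ i ∈ Finset.range (s j), x i ^ 2 :=
      Finset.sum_le_sum_of_subset_of_nonneg (Finset.range_mono (hNs j)) fun i _ _ => sq_nonneg (x i)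
    rw [Finset.sum_Ico_eq_sub _ (s_mono.monotone j.le_succ)]
    push_cast at h1
    linarith

/-- A series of signed terms `c` which are dominated by a square computable sequence converges if
the signs are those of a complex string. -/
theorem tendsto_sum_rademacher_mul {c x : ℕ → ℝ} (hc : ComputableFamily c)
    (hx : IsSquareComputable x) (hcx : ∀ n, |c n| ≤ |x n|) {α : ℕ → Bool} (hα : α ∈ KC) :
    ∃ S : ℝ, Tendsto (fun n => ∑ i ∈ Finset.range n, rademacher α i * c i) atTop (𝓝 S) := by
  obtain ⟨a, b, ha, hb, hab⟩ := hc.exists_dyadic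
  obtain ⟨s, cs, hs, h2s, tail⟩ := exists_computable_blocks hx
  have hle : ∀ j, s j ≤ s (j + 1) := fun j => hs.monotone j.le_succ
  have h2L : ∀ j, 2 * j ≤ s (j + 1) := fun j => (h2s j).trans (hle j)
  have cL : Computable fun j => s (j + 1) := cs.comp Computable.succ
  have cK : Computable fun j => s (j + 1) + 2 * j + 1 :=
    (cL.natAdd ((Computable.const 2).natMul Computable.id)).natAdd (.const 1)
  have cT : Computable fun j => 2 ^ (s (j + 1) + j + 2) :=
    (Computable.const 2).natPow ((cL.natAdd Computable.id).natAdd (.const 2))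
  have cv : Computable₂ fun j => blockCoeff (s j) (fun i => a i (s (j + 1) + 2 * j + 1))
      (fun i => b i (s (j + 1) + 2 * j + 1)) := by
    refine Computable.cond ?_ (Computable.const (0, 0)) (Computable.pair ?_ ?_)
    · exact (Primrec.nat_lt.decide.to_comp).comp Computable.snd (cs.comp Computable.fst)
    · exact ha.comp Computable.snd (cK.comp Computable.fst)
    · exact hb.comp Computable.snd (cK.comp Computable.fst)
  have cH := primrec_exceedingStrings.to_comp.comp
    (cT.pair ((Computable.listMapRange cv cL).pair cL))
  obtain ⟨J, hJ⟩ := eventually_initialSegment_notMem cL cH h2L (fun j =>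
    length_exceedingStrings_blockCoeff_le (hle j) (h2L j) (fun i => hab i _) hcx (tail j)) hα
  refine tendsto_of_block_bound hs (J := J) fun j hj m hm1 hm2 => ?_
  rw [← Finset.sum_Ico_eq_sub _ hm1]
  exact abs_sum_Ico_le_of_notMem_exceedingStrings hm1 hm2 (fun i => hab i _) (hJ j hj)

theorem mainTheorem8 (x φ : ℕ → ℝ) (hx : IsSquareComputable x) (hφ : IsComputableSeq φ)
    (α : ℕ → Bool) (hα : α ∈ KC) (t : ℝ) (ht : IsComputableReal t) :
    ∃ S : ℝ, Tendsto
      (fun N : ℕ => ∑ n ∈ Finset.range N,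
        rademacher α n * x n * Real.cos (2 * Real.pi * n * t + φ n))
      atTop (𝓝 S) := by
  simp only [mul_assoc (rademacher α _)]
  refine tendsto_sum_rademacher_mul (computableFamily_mul_cos hx.isComputableSeq hφ ht) hx
    (fun n => ?_) hα
  rw [abs_mul]
  exact mul_le_of_le_one_right (abs_nonneg _) (Real.abs_cos_le_one _)
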